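/- Let $0<a<\tfrac16$ and let $F:\mathbb R^2\to\mathbb R^2$ be the map $$F(x,y)=(x+2a\sin x+a\sin y,\; y+a\sin x+2a\sin y).$$ Consider the squares $$s_1=\{x-\pi\le y\le x,\ -x\le y\le -x+\pi\},\quad s_2=\{x-\pi\le y\le x,\ -x+\pi\le y\le -x+2\pi\},$$ $$s_3=\{x-2\pi\le y\le x-\pi,\ -x\le y\le -x+\pi\},$$ and let $\gamma^L=W^s(\pi,0)\cap\operatorname{int}(s_1)$, where $W^s(\pi,0)=\{p: F^n(p)\to(\pi,0)\text{ as } n\to+\infty\}$ is the stable manifold of the fixed point $(\pi,0)$. Then: 1. $\gamma^L$ is a heteroclinic curve from $(0,0)$ to $(\pi,0)$: it is the image of an injective continuous curve $c:\mathbb R\to\mathbb R^2$ with $c(t)\to(0,0)$ as $t\to-\infty$ and $c(t)\to(\pi,0)$ as $t\to+\infty$, it satisfies $F(\gamma^L)=\gamma^L$, and every orbit $(X_n)_{n\in\mathbb Z}$ of $F$ with $X_0\in\gamma^L$ satisfies $X_n\to(0,0)$ as $n\to-\infty$ and $X_n\to(\pi,0)$ as $n\to+\infty$. Moreover, for every $x\in(0,\pi)$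 there is exactly one $y$ with $(x,y)\in\gamma^L$; a point $(x,y')$ with $x\in(0,\pi)$ is said to be above (below) $\gamma^L$ if $y'>y$ ($y'<y$) for this $y$. 2. $\operatorname{int}(s_1)$ is negatively invariant: $F^{-1}(\operatorname{int}(s_1))\subseteq\operatorname{int}(s_1)$. 3. The orbit of every $p\in s_1$ above $\gamma^L$ leaves $s_1$ and enters $s_2$: there is $N\ge 0$ such that $F^n(p)\in s_1\setminus s_2$ for $0\le n<N$, $F^n(p)\in s_2$ for all $n\ge N$, and $F^n(p)\notin s_1$ for all $n>N$. 4. The orbit of every $p\in s_1$ below $\gamma^L$ leaves $s_1$ and enters $s_3$, in the same sense with $s_3$ in place of $s_2$. -/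

import Mathlib

open Set Filter Topology

namespace ThreeClocks

noncomputable section

/-- The phase-difference map of three aligned clocks with coupling parameter `a`. -/
def F (a : ℝ) (p : ℝ × ℝ) : ℝ × ℝ :=
  (p.1 + 2 * a * Real.sin p.1 + a * Real.sin p.2,
   p.2 + a * Real.sin p.1 + 2 * a * Real.sin p.2)

/-- The square with vertices `(0,0)`, `(π/2,π/2)`, `(π,0)`, `(π/2,-π/2)`. -/
def s₁ : Set (ℝ × ℝ) :=
  {p | (p.1 - Real.pi ≤ p.2 ∧ p.2 ≤ p.1) ∧ (-p.1 ≤ p.2 ∧ p.2 ≤ -p.1 + Real.pi)}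

/-- The square with vertices `(π,0)`, `(π/2,π/2)`, `(π,π)`, `(3π/2,π/2)`. -/
def s₂ : Set (ℝ × ℝ) :=
  {p | (p.1 - Real.pi ≤ p.2 ∧ p.2 ≤ p.1) ∧
    (-p.1 + Real.pi ≤ p.2 ∧ p.2 ≤ -p.1 + 2 * Real.pi)}

/-- The square with vertices `(π,0)`, `(π/2,-π/2)`, `(π,-π)`, `(3π/2,-π/2)`. -/
def s₃ : Set (ℝ × ℝ) :=
  {p | (p.1 - 2 * Real.pi ≤ p.2 ∧ p.2 ≤ p.1 - Real.pi) ∧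
    (-p.1 ≤ p.2 ∧ p.2 ≤ -p.1 + Real.pi)}

/-- The (global) stable set of a point `Q` under `G`. -/
def stableSet (G : ℝ × ℝ → ℝ × ℝ) (Q : ℝ × ℝ) : Set (ℝ × ℝ) :=
  {p | Tendsto (fun n : ℕ => G^[n] p) atTop (𝓝 Q)}

/-- `γ` is a heteroclinic curve of `G` from `P` to `Q`: an injectively parametrized continuous
curve running from `P` to `Q` (endpoints excluded), strongly invariant under `G`, such that every
complete orbit through a point of `γ` tends to `P` in the past and to `Q` in the future. -/
structure IsHeteroclinicCurve (G : ℝ × ℝ → ℝ × ℝ) (P Q : ℝ × ℝ) (γ : Set (ℝ × ℝ)) : Prop where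
  curve : ∃ c : ℝ → ℝ × ℝ, Continuous c ∧ Function.Injective c ∧ range c = γ ∧
    Tendsto c atBot (𝓝 P) ∧ Tendsto c atTop (𝓝 Q)
  invariant : G '' γ = γ
  orbits : ∀ X : ℤ → ℝ × ℝ, (∀ n, X (n + 1) = G (X n)) → X 0 ∈ γ →
    Tendsto X atBot (𝓝 P) ∧ Tendsto X atTop (𝓝 Q)

/-- The left heteroclinic: the part of the stable manifold of the saddle `(π, 0)` that lies in
the interior of `s₁`. -/
def γL (a : ℝ) : Set (ℝ × ℝ) :=
  stableSet (F a) (Real.pi, 0) ∩ interior s₁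

/-- `p` lies vertically above a point of `γ`. -/
def IsAbove (p : ℝ × ℝ) (γ : Set (ℝ × ℝ)) : Prop :=
  ∃ y, (p.1, y) ∈ γ ∧ y < p.2

/-- `p` lies vertically below a point of `γ`. -/
def IsBelow (p : ℝ × ℝ) (γ : Set (ℝ × ℝ)) : Prop :=
  ∃ y, (p.1, y) ∈ γ ∧ p.2 < y

/-- The forward orbit of `p` under `G` leaves `A` and enters `B`: it stays in `A \ B` before some
time `N`, is in `B` from time `N` on, and is outside `A` after time `N`. (For adjacent closed
regions the orbit may touch the common edge, at time `N` only.) -/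
def LeavesInto (G : ℝ × ℝ → ℝ × ℝ) (p : ℝ × ℝ) (A B : Set (ℝ × ℝ)) : Prop :=
  ∃ N : ℕ, (∀ n < N, G^[n] p ∈ A \ B) ∧ (∀ n ≥ N, G^[n] p ∈ B) ∧ (∀ n > N, G^[n] p ∉ A)

end

end ThreeClocks

namespace ThreeClocks

noncomputable section

/-! In the coordinates u = (x + y)/2, v = (x - y)/2 the map decouples into (u + 3a sin u cos v, v +
a sin v cos u). The square s₁ becomes [0, π/2]², (π, 0) its corner (π/2, π/2), and s₂, s₃ its right
and upper neighbours. Vertical lines become antidiagonals, and "above" becomes "to the right and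
below".

On the square both coordinates are nondecreasing along orbits, so an orbit that stays there
converges to a fixed point, which is the corner unless the orbit starts at the origin
(`tendsto_corner`). Any other orbit exits to the right or upwards and stays in that neighbour. On
each antidiagonal the two kinds of exit define disjoint relatively open sets, each containing an
endpoint; connectedness gives a point in neither (`exists_mem_diagCurve`).

The map is competitive: points in right-below position do not approach each other (`diagMap_gap`).
So the stable set of the corner is a chain (`diagCurve_chain`), that is, a 1-Lipschitz graph over x,
and a point beside it is forced out on its own side (`leavesInto_of_right_of_diagCurve`). Backward
orbits decrease to the origin. -/

/-- The map `F` in the coordinates `((x + y) / 2, (x - y) / 2)`, with independent couplings. -/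
def diagMap (b c : ℝ) (p : ℝ × ℝ) : ℝ × ℝ :=
  (p.1 + b * (Real.sin p.1 * Real.cos p.2), p.2 + c * (Real.sin p.2 * Real.cos p.1))

/-- The square `s₁` in the diagonal coordinates. -/
def baseSquare : Set (ℝ × ℝ) := Icc 0 (Real.pi / 2) ×ˢ Icc 0 (Real.pi / 2)

/-- The square `s₂` in the diagonal coordinates. -/
def rightSquare : Set (ℝ × ℝ) := Icc (Real.pi / 2) Real.pi ×ˢ Icc 0 (Real.pi / 2)

/-- The points to the right of the corner `(π/2, π/2)` and below it. -/
def rightQuadrant : Set (ℝ × ℝ) := Ioi (Real.pi / 2) ×ˢ Iio (Real.pi / 2)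

/-- The stable set of the corner `(π/2, π/2)` inside the open square. -/
def diagCurve (b c : ℝ) : Set (ℝ × ℝ) :=
  stableSet (diagMap b c) (Real.pi / 2, Real.pi / 2) ∩
    (Ioo 0 (Real.pi / 2) ×ˢ Ioo 0 (Real.pi / 2))

/-- The change of coordinates `(x, y) ↦ ((x + y) / 2, (x - y) / 2)`. -/
def diagHomeo : ℝ × ℝ ≃ₜ ℝ × ℝ where
  toFun p := ((p.1 + p.2) / 2, (p.1 - p.2) / 2)
  invFun q := (q.1 + q.2, q.1 - q.2)
  left_inv p := by ext <;> simp <;> ring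
  right_inv p := by ext <;> simp
  continuous_toFun := by fun_prop
  continuous_invFun := by fun_prop

theorem diagHomeo_apply (p : ℝ × ℝ) : diagHomeo p = ((p.1 + p.2) / 2, (p.1 - p.2) / 2) := rfl

theorem continuous_diagMap (b c : ℝ) : Continuous (diagMap b c) := by
  unfold diagMap
  fun_prop

/-- This symmetry is why the couplings are kept independent: each statement about the right exit
gives the one about the upper exit. -/
theorem diagMap_semiconj_swap (b c : ℝ) :
    Function.Semiconj Prod.swap (diagMap b c) (diagMap c b) := fun _ => rfl

theorem iterate_diagMap_swap (b c : ℝ) (n : ℕ) (p : ℝ × ℝ) :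
    (diagMap c b)^[n] p.swap = ((diagMap b c)^[n] p).swap :=
  (((diagMap_semiconj_swap b c).iterate_right n).eq p).symm

/-! ### One-step estimates and the exits from the square -/

theorem abs_sin_mul_cos_le_left (s t : ℝ) : |Real.sin s * Real.cos t| ≤ |s| := by
  rw [abs_mul]
  calc |Real.sin s| * |Real.cos t| ≤ |s| * 1 :=
        mul_le_mul Real.abs_sin_le_abs (Real.abs_cos_le_one t) (abs_nonneg _) (abs_nonneg _)
    _ = |s| := mul_one _

theorem abs_sin_mul_cos_le_pi_sub (s t : ℝ) : |Real.sin s * Real.cos t| ≤ |Real.pi - s| := by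
  rw [← Real.sin_pi_sub]
  exact abs_sin_mul_cos_le_left _ _

theorem abs_sin_mul_cos_le_right (s t : ℝ) : |Real.sin s * Real.cos t| ≤ |Real.pi / 2 - t| := by
  rw [← Real.sin_pi_div_two_sub t, ← Real.cos_pi_div_two_sub s, mul_comm]
  exact abs_sin_mul_cos_le_left _ _

/-- Couplings below 1/2 (from 3a < 1/2) make a displacement at most half the distance appearing in
the three bounds above. -/
theorem abs_coupling_mul_le {b s d : ℝ} (hb : 0 < b) (hb' : b < 1 / 2) (h : |s| ≤ d) :
    |b * s| ≤ d / 2 := by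
  rw [abs_mul, abs_of_pos hb]
  nlinarith [abs_nonneg s]

variable {b c : ℝ}

theorem sin_mul_cos_nonneg {p : ℝ × ℝ} (hp : p ∈ baseSquare) :
    0 ≤ Real.sin p.1 * Real.cos p.2 ∧ 0 ≤ Real.sin p.2 * Real.cos p.1 := by
  obtain ⟨⟨h1, h2⟩, h3, h4⟩ := hp
  have hpi := Real.pi_pos
  exact ⟨mul_nonneg (Real.sin_nonneg_of_nonneg_of_le_pi h1 (by linarith))
      (Real.cos_nonneg_of_neg_pi_div_two_le_of_le (by linarith) h4),
    mul_nonneg (Real.sin_nonneg_of_nonneg_of_le_pi h3 (by linarith))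
      (Real.cos_nonneg_of_neg_pi_div_two_le_of_le (by linarith) h2)⟩

theorem le_diagMap (hb : 0 < b) (hc : 0 < c) {p : ℝ × ℝ} (hp : p ∈ baseSquare) :
    p ≤ diagMap b c p := by
  obtain ⟨h1, h2⟩ := sin_mul_cos_nonneg hp
  exact ⟨le_add_of_nonneg_right (mul_nonneg hb.le h1),
    le_add_of_nonneg_right (mul_nonneg hc.le h2)⟩

/-- Each coordinate advances by at most half the other's distance to π/2, so both cannot pass π/2 in
one step. -/
theorem diagMap_mem_of_mem_baseSquare (hb : 0 < b) (hb' : b < 1 / 2) (hc : 0 < c)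
    (hc' : c < 1 / 2) {p : ℝ × ℝ} (hp : p ∈ baseSquare) :
    diagMap b c p ∈ baseSquare ∨
    (diagMap b c p ∈ rightSquare ∧ diagMap b c p ∈ rightQuadrant) ∨
    ((diagMap b c p).swap ∈ rightSquare ∧ (diagMap b c p).swap ∈ rightQuadrant) := by
  obtain ⟨hs1, hs2⟩ := le_diagMap hb hc hp
  have hpi := Real.pi_gt_three
  have e1 := (abs_le.1 (abs_coupling_mul_le hb hb' (abs_sin_mul_cos_le_right p.1 p.2))).2
  have e2 := (abs_le.1 (abs_coupling_mul_le hc hc' (abs_sin_mul_cos_le_right p.2 p.1))).2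
  obtain ⟨⟨h1, h2⟩, h3, h4⟩ := hp
  rw [abs_of_nonneg (by linarith)] at e1 e2
  have g1 : (diagMap b c p).1 = p.1 + b * (Real.sin p.1 * Real.cos p.2) := rfl
  have g2 : (diagMap b c p).2 = p.2 + c * (Real.sin p.2 * Real.cos p.1) := rfl
  simp only [baseSquare, rightSquare, rightQuadrant, mem_prod, mem_Icc, mem_Ioi, mem_Iio,
    Prod.fst_swap, Prod.snd_swap]
  rcases le_or_gt (diagMap b c p).1 (Real.pi / 2) with k1 | k1
  · rcases le_or_gt (diagMap b c p).2 (Real.pi / 2) with k2 | k2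
    · exact Or.inl ⟨⟨by linarith, k1⟩, by linarith, k2⟩
    · exact Or.inr (Or.inr ⟨⟨⟨by linarith, by linarith⟩, by linarith, k1⟩, k2, by linarith⟩)
  · exact Or.inr (Or.inl ⟨⟨⟨by linarith, by linarith⟩, by linarith, by linarith⟩, k1, by linarith⟩)

theorem diagMap_mem_rightSquare (hb : 0 < b) (hb' : b < 1 / 2) (hc : 0 < c)
    (hc' : c < 1 / 2) {p : ℝ × ℝ} (hp : p ∈ rightSquare) :
    diagMap b c p ∈ rightSquare ∧ p.1 ≤ (diagMap b c p).1 := by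
  obtain ⟨⟨h1, h2⟩, h3, h4⟩ := hp
  have hpi := Real.pi_pos
  have g1 : (diagMap b c p).1 = p.1 + b * (Real.sin p.1 * Real.cos p.2) := rfl
  have g2 : (diagMap b c p).2 = p.2 + c * (Real.sin p.2 * Real.cos p.1) := rfl
  have e1 := (abs_le.1 (abs_coupling_mul_le hb hb' (abs_sin_mul_cos_le_pi_sub p.1 p.2))).2
  have e2 := (abs_le.1 (abs_coupling_mul_le hc hc' (abs_sin_mul_cos_le_left p.2 p.1))).1
  rw [abs_of_nonneg (by linarith)] at e1 e2
  have n1 : 0 ≤ b * (Real.sin p.1 * Real.cos p.2) := mul_nonneg hb.le <|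
    mul_nonneg (Real.sin_nonneg_of_nonneg_of_le_pi (by linarith) h2)
      (Real.cos_nonneg_of_neg_pi_div_two_le_of_le (by linarith) h4)
  have n2 : c * (Real.sin p.2 * Real.cos p.1) ≤ 0 := mul_nonpos_of_nonneg_of_nonpos hc.le <|
    mul_nonpos_of_nonneg_of_nonpos (Real.sin_nonneg_of_nonneg_of_le_pi h3 (by linarith))
      (Real.cos_nonpos_of_pi_div_two_le_of_le h1 (by linarith))
  simp only [rightSquare, mem_prod, mem_Icc]
  exact ⟨⟨⟨by linarith, by linarith⟩, by linarith, by linarith⟩, by linarith⟩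

theorem pi_div_two_lt_diagMap_fst (hb : 0 < b) {p : ℝ × ℝ} (hp : p ∈ rightSquare)
    (hlt : p.2 < Real.pi / 2) : Real.pi / 2 < (diagMap b c p).1 := by
  obtain ⟨⟨h1, h2⟩, h3, -⟩ := hp
  have hpi := Real.pi_pos
  have g1 : (diagMap b c p).1 = p.1 + b * (Real.sin p.1 * Real.cos p.2) := rfl
  have hcos : 0 < Real.cos p.2 := Real.cos_pos_of_mem_Ioo ⟨by linarith, hlt⟩
  rcases h2.lt_or_eq with h | h
  · have := mul_pos hb (mul_pos (Real.sin_pos_of_pos_of_lt_pi (by linarith) h) hcos)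
    linarith
  · rw [g1, h, Real.sin_pi]
    linarith

theorem iterate_mem_rightSquare (hb : 0 < b) (hb' : b < 1 / 2) (hc : 0 < c)
    (hc' : c < 1 / 2) {p : ℝ × ℝ} {m n : ℕ} (hmn : m ≤ n)
    (hm : (diagMap b c)^[m] p ∈ rightSquare) :
    (diagMap b c)^[n] p ∈ rightSquare ∧ ((diagMap b c)^[m] p).1 ≤ ((diagMap b c)^[n] p).1 := by
  induction n, hmn using Nat.le_induction with
  | base => exact ⟨hm, le_rfl⟩
  | succ n _ ih =>
    rw [Function.iterate_succ_apply']
    have := diagMap_mem_rightSquare hb hb' hc hc' ih.1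
    exact ⟨this.1, ih.2.trans this.2⟩

/-- The map does not bring two points of the square closer together when one lies to the right of
the other and below it. -/
theorem diagMap_gap (hb : 0 < b) (hc : 0 < c) {p q : ℝ × ℝ} (hp : p ∈ baseSquare)
    (hq : q ∈ baseSquare) (h1 : q.1 ≤ p.1) (h2 : p.2 ≤ q.2) :
    p.1 - q.1 ≤ (diagMap b c p).1 - (diagMap b c q).1 ∧
    q.2 - p.2 ≤ (diagMap b c q).2 - (diagMap b c p).2 := by
  have hpi := Real.pi_pos
  obtain ⟨⟨p1, p2⟩, p3, p4⟩ := hp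
  obtain ⟨⟨q1, q2⟩, q3, q4⟩ := hq
  have s1 := Real.sin_le_sin_of_le_of_le_pi_div_two (by linarith) p2 h1
  have s2 := Real.sin_le_sin_of_le_of_le_pi_div_two (by linarith) q4 h2
  have c1 := Real.cos_le_cos_of_nonneg_of_le_pi q1 (by linarith) h1
  have c2 := Real.cos_le_cos_of_nonneg_of_le_pi p3 (by linarith) h2
  -- On the square, sin u cos v increases in u and decreases in v; sin v cos u does the opposite.
  have m1 : Real.sin q.1 * Real.cos q.2 ≤ Real.sin p.1 * Real.cos p.2 :=
    mul_le_mul s1 c2 (Real.cos_nonneg_of_neg_pi_div_two_le_of_le (by linarith) q4)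
      (Real.sin_nonneg_of_nonneg_of_le_pi p1 (by linarith))
  have m2 : Real.sin p.2 * Real.cos p.1 ≤ Real.sin q.2 * Real.cos q.1 :=
    mul_le_mul s2 c1 (Real.cos_nonneg_of_neg_pi_div_two_le_of_le (by linarith) p2)
      (Real.sin_nonneg_of_nonneg_of_le_pi q3 (by linarith))
  have m3 := mul_le_mul_of_nonneg_left m1 hb.le
  have m4 := mul_le_mul_of_nonneg_left m2 hc.le
  simp only [diagMap]
  constructor <;> linarith

theorem iterate_gap (hb : 0 < b) (hc : 0 < c) {p q : ℝ × ℝ} {N : ℕ}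
    (hp : ∀ n < N, (diagMap b c)^[n] p ∈ baseSquare)
    (hq : ∀ n < N, (diagMap b c)^[n] q ∈ baseSquare) (h1 : q.1 ≤ p.1) (h2 : p.2 ≤ q.2) :
    p.1 - q.1 ≤ ((diagMap b c)^[N] p).1 - ((diagMap b c)^[N] q).1 ∧
    q.2 - p.2 ≤ ((diagMap b c)^[N] q).2 - ((diagMap b c)^[N] p).2 := by
  induction N with
  | zero => exact ⟨le_rfl, le_rfl⟩
  | succ N ih =>
    obtain ⟨i1, i2⟩ := ih (fun n hn => hp n (by omega)) (fun n hn => hq n (by omega))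
    rw [Function.iterate_succ_apply', Function.iterate_succ_apply']
    obtain ⟨j1, j2⟩ := diagMap_gap hb hc (hp N (by omega)) (hq N (by omega))
      (by linarith) (by linarith)
    exact ⟨i1.trans j1, i2.trans j2⟩

theorem eq_of_diagMap_eq_self (hb : 0 < b) (hc : 0 < c) {p : ℝ × ℝ} (hp : p ∈ baseSquare)
    (h : diagMap b c p = p) : p = (0, 0) ∨ p = (Real.pi / 2, Real.pi / 2) := by
  obtain ⟨⟨p1, p2⟩, p3, p4⟩ := hp
  have hpi := Real.pi_pos
  have g1 : p.1 + b * (Real.sin p.1 * Real.cos p.2) = p.1 := congrArg Prod.fst h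
  have g2 : p.2 + c * (Real.sin p.2 * Real.cos p.1) = p.2 := congrArg Prod.snd h
  have sin_pos : ∀ t, 0 < t → t ≤ Real.pi / 2 → 0 < Real.sin t := fun t h h' =>
    Real.sin_pos_of_pos_of_lt_pi h (by linarith)
  have cos_pos : ∀ t, 0 ≤ t → t < Real.pi / 2 → 0 < Real.cos t := fun t h h' =>
    Real.cos_pos_of_mem_Ioo ⟨by linarith, h'⟩
  rcases p1.lt_or_eq with k1 | k1
  · rcases p4.lt_or_eq with k2 | k2
    · have := mul_pos hb (mul_pos (sin_pos _ k1 p2) (cos_pos _ p3 k2))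
      linarith
    · rcases p2.lt_or_eq with k3 | k3
      · have := mul_pos hc (mul_pos (sin_pos p.2 (by linarith) p4) (cos_pos _ p1 k3))
        linarith
      · exact Or.inr (Prod.ext k3 k2)
  · rcases p3.lt_or_eq with k2 | k2
    · have := mul_pos hc (mul_pos (sin_pos _ k2 p4) (cos_pos p.1 p1 (by linarith)))
      linarith
    · exact Or.inl (Prod.ext k1.symm k2.symm)

theorem isClosed_baseSquare : IsClosed baseSquare := isClosed_Icc.prod isClosed_Icc

theorem tendsto_corner (hb : 0 < b) (hc : 0 < c) {p : ℝ × ℝ}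
    (hp : ∀ n, (diagMap b c)^[n] p ∈ baseSquare) (hp0 : p ≠ (0, 0)) :
    Tendsto (fun n => (diagMap b c)^[n] p) atTop (𝓝 (Real.pi / 2, Real.pi / 2)) := by
  have hmono : Monotone fun n => (diagMap b c)^[n] p := monotone_nat_of_le_succ fun n => by
    rw [Function.iterate_succ_apply']
    exact le_diagMap hb hc (hp n)
  have ht1 := tendsto_atTop_ciSup (monotone_fst.comp hmono)
    ⟨Real.pi / 2, by rintro _ ⟨n, rfl⟩; exact (hp n).1.2⟩
  have ht2 := tendsto_atTop_ciSup (monotone_snd.comp hmono)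
    ⟨Real.pi / 2, by rintro _ ⟨n, rfl⟩; exact (hp n).2.2⟩
  obtain ⟨L, ht⟩ : ∃ L, Tendsto (fun n => (diagMap b c)^[n] p) atTop (𝓝 L) := ⟨_, ht1.prodMk_nhds ht2⟩
  have hLmem : L ∈ baseSquare := isClosed_baseSquare.mem_of_tendsto ht (Eventually.of_forall hp)
  have hfix : diagMap b c L = L :=
    isFixedPt_of_tendsto_iterate ht (continuous_diagMap b c).continuousAt
  have hle : p ≤ L := hmono.ge_of_tendsto ht 0
  rcases eq_of_diagMap_eq_self hb hc hLmem hfix with h | h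
  · rw [h] at hle
    exact absurd (Prod.ext (le_antisymm hle.1 (hp 0).1.1) (le_antisymm hle.2 (hp 0).2.1)) hp0
  · rwa [h] at ht

theorem iterate_mem_trichotomy (hb : 0 < b) (hb' : b < 1 / 2) (hc : 0 < c)
    (hc' : c < 1 / 2) {p : ℝ × ℝ} (hp : p ∈ baseSquare) (n : ℕ) :
    (diagMap b c)^[n] p ∈ baseSquare ∨ (diagMap b c)^[n] p ∈ rightSquare ∨
      ((diagMap b c)^[n] p).swap ∈ rightSquare := by
  induction n with
  | zero => exact Or.inl hp
  | succ n ih =>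
    rw [Function.iterate_succ_apply']
    rcases ih with h | h | h
    · rcases diagMap_mem_of_mem_baseSquare hb hb' hc hc' h with h | h | h
      · exact Or.inl h
      · exact Or.inr (Or.inl h.1)
      · exact Or.inr (Or.inr h.1)
    · exact Or.inr (Or.inl (diagMap_mem_rightSquare hb hb' hc hc' h).1)
    · refine Or.inr (Or.inr ?_)
      rw [(diagMap_semiconj_swap b c).eq]
      exact (diagMap_mem_rightSquare hc hc' hb hb' h).1

/-- Exits are detected by the open quadrant, as connectedness requires, while the trapping region is
the closed square. -/
theorem mem_rightSquare_of_mem_rightQuadrant (hb : 0 < b) (hb' : b < 1 / 2) (hc : 0 < c)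
    (hc' : c < 1 / 2) {p : ℝ × ℝ} (hp : p ∈ baseSquare) {n : ℕ}
    (hn : (diagMap b c)^[n] p ∈ rightQuadrant) : (diagMap b c)^[n] p ∈ rightSquare := by
  rcases iterate_mem_trichotomy hb hb' hc hc' hp n with h | h | h
  · exact absurd hn.1 (not_lt.2 h.1.2)
  · exact h
  · exact absurd hn.1 (not_lt.2 h.2.2)

theorem swap_mem_baseSquare {p : ℝ × ℝ} : p.swap ∈ baseSquare ↔ p ∈ baseSquare :=
  and_comm

theorem not_mem_both_quadrants_of_le (hb : 0 < b) (hb' : b < 1 / 2) (hc : 0 < c)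
    (hc' : c < 1 / 2) {p : ℝ × ℝ} (hp : p ∈ baseSquare) {m n : ℕ} (hmn : m ≤ n)
    (hm : (diagMap b c)^[m] p ∈ rightQuadrant) :
    ((diagMap b c)^[n] p).swap ∉ rightQuadrant := by
  intro h
  have := (iterate_mem_rightSquare hb hb' hc hc' hmn
    (mem_rightSquare_of_mem_rightQuadrant hb hb' hc hc' hp hm)).1
  exact absurd h.1 (not_lt.2 this.2.2)

theorem not_mem_both_quadrants (hb : 0 < b) (hb' : b < 1 / 2) (hc : 0 < c)
    (hc' : c < 1 / 2) {p : ℝ × ℝ} (hp : p ∈ baseSquare) {m n : ℕ}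
    (hm : (diagMap b c)^[m] p ∈ rightQuadrant) :
    ((diagMap b c)^[n] p).swap ∉ rightQuadrant := by
  rcases le_total m n with h | h
  · exact not_mem_both_quadrants_of_le hb hb' hc hc' hp h hm
  · intro hn
    rw [← iterate_diagMap_swap] at hn
    have := not_mem_both_quadrants_of_le hc hc' hb hb' (swap_mem_baseSquare.2 hp) h hn
    rw [iterate_diagMap_swap, Prod.swap_swap] at this
    exact this hm

theorem forall_mem_baseSquare (hb : 0 < b) (hb' : b < 1 / 2) (hc : 0 < c)
    (hc' : c < 1 / 2) {p : ℝ × ℝ} (hp : p ∈ baseSquare)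
    (h1 : ∀ n, (diagMap b c)^[n] p ∉ rightQuadrant)
    (h2 : ∀ n, ((diagMap b c)^[n] p).swap ∉ rightQuadrant) (n : ℕ) :
    (diagMap b c)^[n] p ∈ baseSquare := by
  induction n with
  | zero => exact hp
  | succ n ih =>
    have k1 := h1 (n + 1)
    have k2 := h2 (n + 1)
    rw [Function.iterate_succ_apply'] at k1 k2 ⊢
    rcases diagMap_mem_of_mem_baseSquare hb hb' hc hc' ih with h | h | h
    · exact h
    · exact absurd h.2 k1
    · exact absurd h.2 k2

/-! ### Existence of stable points on antidiagonals -/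

theorem iterate_diagMap_snd_eq_zero {p : ℝ × ℝ} (h : p.2 = 0) (n : ℕ) :
    ((diagMap b c)^[n] p).2 = 0 := by
  induction n with
  | zero => exact h
  | succ n ih =>
    rw [Function.iterate_succ_apply']
    simp [diagMap, ih]

/-- The line v = 0 is invariant, so without a right exit the orbit would tend to the corner while
keeping v = 0. -/
theorem exists_mem_rightQuadrant_of_snd_eq_zero (hb : 0 < b) (hb' : b < 1 / 2) (hc : 0 < c)
    (hc' : c < 1 / 2) {p : ℝ × ℝ} (hp : p ∈ baseSquare) (h1 : 0 < p.1) (h2 : p.2 = 0) :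
    ∃ n, (diagMap b c)^[n] p ∈ rightQuadrant := by
  have hpi := Real.pi_pos
  by_contra! h
  have hmem := forall_mem_baseSquare hb hb' hc hc' hp h fun n hn => by
    have h3 : Real.pi / 2 < ((diagMap b c)^[n] p).2 := hn.1
    rw [iterate_diagMap_snd_eq_zero h2] at h3
    linarith
  have ht := tendsto_corner hb hc hmem fun h => by simp [h] at h1
  have h3 := ht.snd_nhds
  simp only [iterate_diagMap_snd_eq_zero h2] at h3
  have := tendsto_nhds_unique h3 tendsto_const_nhds
  linarith

theorem exists_mem_rightQuadrant_of_fst_eq (hb : 0 < b) (hb' : b < 1 / 2) (hc : 0 < c)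
    (hc' : c < 1 / 2) {p : ℝ × ℝ} (hp : p ∈ baseSquare) (h1 : p.1 = Real.pi / 2)
    (h2 : p.2 < Real.pi / 2) : ∃ n, (diagMap b c)^[n] p ∈ rightQuadrant := by
  have hpi := Real.pi_pos
  have hr : p ∈ rightSquare := ⟨⟨h1.ge, by linarith⟩, hp.2⟩
  have hlt := pi_div_two_lt_diagMap_fst (c := c) hb hr h2
  refine ⟨1, ?_⟩
  rcases diagMap_mem_of_mem_baseSquare hb hb' hc hc' hp with h | h | h
  · exact absurd hlt (not_lt.2 h.1.2)
  · exact h.2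
  · exact absurd hlt (not_lt.2 h.1.2.2)

theorem isOpen_rightQuadrant : IsOpen rightQuadrant := isOpen_Ioi.prod isOpen_Iio

/-- Every antidiagonal of the square meets the stable set of the corner. -/
theorem exists_mem_diagCurve (hb : 0 < b) (hb' : b < 1 / 2) (hc : 0 < c)
    (hc' : c < 1 / 2) {x : ℝ} (hx : x ∈ Ioo 0 Real.pi) :
    ∃ t, (t, x - t) ∈ diagCurve b c := by
  obtain ⟨hx0, hx1⟩ := hx
  -- `l` and `r` are the ends of the segment that the antidiagonal u + v = x cuts from the square.
  set l := max 0 (x - Real.pi / 2) with hl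
  set r := min x (Real.pi / 2) with hr
  have hlr : l ≤ r := max_le (le_min hx0.le (by linarith)) (le_min (by linarith) (by linarith))
  have hmem : ∀ t ∈ Icc l r, (t, x - t) ∈ baseSquare := fun t ht => by
    obtain ⟨h1, h2⟩ := ht
    rw [hl, max_le_iff] at h1
    rw [hr, le_min_iff] at h2
    exact ⟨⟨h1.1, h2.2⟩, by simpa using h2.1, by simp; linarith⟩
  let U : Set ℝ := {t | ∃ n, (diagMap b c)^[n] (t, x - t) ∈ rightQuadrant}
  let V : Set ℝ := {t | ∃ n, ((diagMap b c)^[n] (t, x - t)).swap ∈ rightQuadrant}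
  have hcont : ∀ n, Continuous fun t : ℝ => (diagMap b c)^[n] (t, x - t) := fun n =>
    ((continuous_diagMap b c).iterate n).comp (by fun_prop)
  have hU : IsOpen U := by
    simp only [U, ofPred_exists]
    exact isOpen_iUnion fun n => isOpen_rightQuadrant.preimage (hcont n)
  have hV : IsOpen V := by
    simp only [V, ofPred_exists]
    exact isOpen_iUnion fun n => isOpen_rightQuadrant.preimage (continuous_swap.comp (hcont n))
  have hrU : r ∈ U := by
    have hm := hmem r ⟨hlr, le_rfl⟩
    rcases le_total x (Real.pi / 2) with h | h
    · rw [min_eq_left h] at hr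
      exact exists_mem_rightQuadrant_of_snd_eq_zero hb hb' hc hc' hm (by simpa [hr]) (by simp [hr])
    · rw [min_eq_right h] at hr
      exact exists_mem_rightQuadrant_of_fst_eq hb hb' hc hc' hm hr (by simp [hr]; linarith)
  have hlV : l ∈ V := by
    have hm := swap_mem_baseSquare.2 (hmem l ⟨le_rfl, hlr⟩)
    simp only [V, mem_ofPred_eq, ← iterate_diagMap_swap]
    rcases le_total x (Real.pi / 2) with h | h
    · rw [max_eq_left (by linarith)] at hl
      exact exists_mem_rightQuadrant_of_snd_eq_zero hc hc' hb hb' hm (by simpa [hl]) (by simp [hl])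
    · rw [max_eq_right (by linarith)] at hl
      exact exists_mem_rightQuadrant_of_fst_eq hc hc' hb hb' hm (by simp [hl])
        (by simp [hl]; linarith)
  obtain ⟨t, ht, htU, htV⟩ : ∃ t ∈ Icc l r, t ∉ U ∧ t ∉ V := by
    by_contra! h
    obtain ⟨t, ht, ⟨m, hm⟩, n, hn⟩ := isPreconnected_Icc U V hU hV
      (fun t ht => or_iff_not_imp_left.2 (h t ht)) ⟨r, ⟨hlr, le_rfl⟩, hrU⟩ ⟨l, ⟨le_rfl, hlr⟩, hlV⟩
    exact not_mem_both_quadrants hb hb' hc hc' (hmem t ht) hm hn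
  have hall := forall_mem_baseSquare hb hb' hc hc' (hmem t ht) (not_exists.1 htU)
    (not_exists.1 htV)
  have hlim := tendsto_corner hb hc hall fun h => by
    have h1 : t = 0 := congrArg Prod.fst h
    have h2 : x - t = 0 := congrArg Prod.snd h
    linarith
  obtain ⟨⟨t1, t2⟩, t3, t4⟩ := hmem t ht
  simp only at t1 t2 t3 t4
  have hm := hmem t ht
  have hm' := swap_mem_baseSquare.2 hm
  have htV' : ¬ ∃ n, (diagMap c b)^[n] (t, x - t).swap ∈ rightQuadrant := by
    simp only [iterate_diagMap_swap]
    exact htV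
  -- A point on an edge of the square would exit, so it would lie in `U` or `V`.
  refine ⟨t, hlim, ⟨t1.lt_of_ne fun h => ?_, t2.lt_of_ne fun h => ?_⟩,
    t3.lt_of_ne fun h => ?_, t4.lt_of_ne fun h => ?_⟩
  · exact htV' (exists_mem_rightQuadrant_of_snd_eq_zero hc hc' hb hb' hm' (by simp; linarith) h.symm)
  · exact htU (exists_mem_rightQuadrant_of_fst_eq hb hb' hc hc' hm h (by simp; linarith))
  · exact htU (exists_mem_rightQuadrant_of_snd_eq_zero hb hb' hc hc' hm (by simp; linarith) h.symm)
  · exact htV' (exists_mem_rightQuadrant_of_fst_eq hc hc' hb hb' hm' h (by simp; linarith))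

/-! ### Invariance and order structure of the stable set -/

theorem mem_baseSquare_of_mem_diagCurve {p : ℝ × ℝ} (hp : p ∈ diagCurve b c) : p ∈ baseSquare :=
  ⟨Ioo_subset_Icc_self hp.2.1, Ioo_subset_Icc_self hp.2.2⟩

theorem swap_mem_diagCurve {p : ℝ × ℝ} (hp : p ∈ diagCurve b c) : p.swap ∈ diagCurve c b := by
  refine ⟨?_, hp.2.2, hp.2.1⟩
  have := (continuous_swap.tendsto _).comp hp.1
  simpa [stableSet, iterate_diagMap_swap, Function.comp_def] using this

/-- After a right exit u never decreases, so it cannot return to π/2 in the limit. -/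
theorem not_mem_rightQuadrant_of_mem_diagCurve (hb : 0 < b) (hb' : b < 1 / 2) (hc : 0 < c)
    (hc' : c < 1 / 2) {p : ℝ × ℝ} (hp : p ∈ diagCurve b c) (n : ℕ) :
    (diagMap b c)^[n] p ∉ rightQuadrant := by
  intro hn
  have hr := mem_rightSquare_of_mem_rightQuadrant hb hb' hc hc'
    (mem_baseSquare_of_mem_diagCurve hp) hn
  have hlim : Tendsto (fun n => (diagMap b c)^[n] p) atTop _ := hp.1
  have := ge_of_tendsto hlim.fst_nhds <| (eventually_ge_atTop n).mono fun m hm =>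
    (iterate_mem_rightSquare hb hb' hc hc' hm hr).2
  exact absurd hn.1 (not_lt.2 this)

theorem iterate_mem_baseSquare_of_mem_diagCurve (hb : 0 < b) (hb' : b < 1 / 2) (hc : 0 < c)
    (hc' : c < 1 / 2) {p : ℝ × ℝ} (hp : p ∈ diagCurve b c) (n : ℕ) :
    (diagMap b c)^[n] p ∈ baseSquare :=
  forall_mem_baseSquare hb hb' hc hc' (mem_baseSquare_of_mem_diagCurve hp)
    (not_mem_rightQuadrant_of_mem_diagCurve hb hb' hc hc' hp)
    (fun n => iterate_diagMap_swap b c n p ▸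
      not_mem_rightQuadrant_of_mem_diagCurve hc hc' hb hb' (swap_mem_diagCurve hp) n) n

theorem diagMap_mem_diagCurve (hb : 0 < b) (hb' : b < 1 / 2) (hc : 0 < c)
    (hc' : c < 1 / 2) {p : ℝ × ℝ} (hp : p ∈ diagCurve b c) :
    diagMap b c p ∈ diagCurve b c := by
  have key : ∀ {b c : ℝ}, 0 < b → b < 1 / 2 → 0 < c → c < 1 / 2 → ∀ {p}, p ∈ diagCurve b c →
      (diagMap b c p).1 < Real.pi / 2 := by
    intro b c hb hb' hc hc' p hp
    have h1 := iterate_mem_baseSquare_of_mem_diagCurve hb hb' hc hc' hp 1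
    have h2 := not_mem_rightQuadrant_of_mem_diagCurve hb hb' hc hc' hp
    refine h1.1.2.lt_of_ne fun h => ?_
    rcases h1.2.2.lt_or_eq with h3 | h3
    · obtain ⟨n, hn⟩ := exists_mem_rightQuadrant_of_fst_eq hb hb' hc hc' h1 h h3
      exact h2 (n + 1) (by rwa [Function.iterate_add_apply])
    -- The corner is not reached in one step: each distance to π/2 would be at most half the other.
    · have e1 := (abs_le.1 (abs_coupling_mul_le hb hb' (abs_sin_mul_cos_le_right p.1 p.2))).2
      have e2 := (abs_le.1 (abs_coupling_mul_le hc hc' (abs_sin_mul_cos_le_right p.2 p.1))).2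
      obtain ⟨-, ⟨-, p2⟩, -, p4⟩ := hp
      rw [abs_of_nonneg (by linarith)] at e1 e2
      simp only [Function.iterate_one, diagMap] at h h3
      linarith
  have hle := le_diagMap hb hc (mem_baseSquare_of_mem_diagCurve hp)
  refine ⟨?_, ⟨hp.2.1.1.trans_le hle.1, key hb hb' hc hc' hp⟩,
    hp.2.2.1.trans_le hle.2, key hc hc' hb hb' (swap_mem_diagCurve hp)⟩
  have hlim : Tendsto (fun n => (diagMap b c)^[n] p) atTop _ := hp.1
  exact (tendsto_add_atTop_iff_nat 1).2 hlim

/-- The stable set of the corner is a chain for the product order. -/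
theorem diagCurve_chain (hb : 0 < b) (hb' : b < 1 / 2) (hc : 0 < c)
    (hc' : c < 1 / 2) {p q : ℝ × ℝ} (hp : p ∈ diagCurve b c) (hq : q ∈ diagCurve b c)
    (h1 : q.1 ≤ p.1) (h2 : p.2 ≤ q.2) : p = q := by
  -- The initial gap persists along both orbits, but their common limit forces it to vanish.
  have hgap := fun n => iterate_gap (N := n) hb hc
    (fun n _ => iterate_mem_baseSquare_of_mem_diagCurve hb hb' hc hc' hp n)
    (fun n _ => iterate_mem_baseSquare_of_mem_diagCurve hb hb' hc hc' hq n) h1 h2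
  have hlp : Tendsto (fun n => (diagMap b c)^[n] p) atTop _ := hp.1
  have hlq : Tendsto (fun n => (diagMap b c)^[n] q) atTop _ := hq.1
  have k1 := ge_of_tendsto' (hlp.fst_nhds.sub hlq.fst_nhds) fun n => (hgap n).1
  have k2 := ge_of_tendsto' (hlq.snd_nhds.sub hlp.snd_nhds) fun n => (hgap n).2
  exact Prod.ext (by linarith) (by linarith)

/-- The orbit of `q` stays in the square and tends to the corner. The persisting gap keeps `p` off
the upper exit and rules out its staying in the square. -/
theorem leavesInto_of_right_of_diagCurve (hb : 0 < b) (hb' : b < 1 / 2) (hc : 0 < c)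
    (hc' : c < 1 / 2) {p q : ℝ × ℝ} (hp : p ∈ baseSquare) (hq : q ∈ diagCurve b c)
    (h1 : q.1 < p.1) (h2 : p.2 < q.2) :
    LeavesInto (diagMap b c) p baseSquare rightSquare := by
  have hqmem := iterate_mem_baseSquare_of_mem_diagCurve hb hb' hc hc' hq
  have hgap := fun (n : ℕ) (hn : ∀ m < n, (diagMap b c)^[m] p ∈ baseSquare) =>
    iterate_gap hb hc hn (fun m _ => hqmem m) h1.le h2.le
  have hstep : ∀ n, (∀ m < n, (diagMap b c)^[m] p ∈ baseSquare) →
      (diagMap b c)^[n] p ∉ rightSquare → (diagMap b c)^[n] p ∈ baseSquare := by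
    intro n hn hr
    rcases iterate_mem_trichotomy hb hb' hc hc' hp n with h | h | h
    · exact h
    · exact absurd h hr
    · have h3 : Real.pi / 2 ≤ ((diagMap b c)^[n] p).2 := h.1.1
      have := (hqmem n).2.2
      have := (hgap n hn).2
      linarith
  have hex : ∃ n, (diagMap b c)^[n] p ∈ rightSquare := by
    by_contra! h
    have hmem : ∀ n, (diagMap b c)^[n] p ∈ baseSquare := fun n =>
      Nat.strong_induction_on n fun n ih => hstep n ih (h n)
    have hlq : Tendsto (fun n => (diagMap b c)^[n] q) atTop _ := hq.1
    have := ge_of_tendsto' (tendsto_const_nhds.sub hlq.fst_nhds) fun n =>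
      (hgap n fun m _ => hmem m).1.trans (sub_le_sub_right (hmem n).1.2 _)
    linarith
  classical
  have hbefore : ∀ n < Nat.find hex, (diagMap b c)^[n] p ∈ baseSquare := fun n =>
    Nat.strong_induction_on n fun n ih hn =>
      hstep n (fun m hm => ih m hm (hm.trans hn)) (Nat.find_min hex hn)
  refine ⟨Nat.find hex, fun n hn => ⟨hbefore n hn, Nat.find_min hex hn⟩,
    fun n hn => (iterate_mem_rightSquare hb hb' hc hc' hn (Nat.find_spec hex)).1, fun n hn h => ?_⟩
  -- The entry point may lie on the common edge u = π/2, but below the corner, so the next step is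
  -- strictly past it.
  have hlt : ((diagMap b c)^[Nat.find hex] p).2 < Real.pi / 2 := by
    have := (hqmem (Nat.find hex)).2.2
    have := (hgap _ hbefore).2
    linarith
  have k1 := pi_div_two_lt_diagMap_fst (c := c) hb (Nat.find_spec hex) hlt
  have k2 := diagMap_mem_rightSquare hb hb' hc hc' (Nat.find_spec hex)
  rw [← Function.iterate_succ_apply' (diagMap b c)] at k1 k2
  exact absurd (k1.trans_le (iterate_mem_rightSquare hb hb' hc hc' hn k2.1).2) (not_lt.2 h.1.2)

/-! ### Backward dynamics -/

theorem fst_mem_Ioo_of_diagMap (hb : 0 < b) (hb' : b < 1 / 2) {p : ℝ × ℝ}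
    (h : (diagMap b c p).1 ∈ Ioo 0 Real.pi) : p.1 ∈ Ioo 0 Real.pi := by
  have e1 := abs_le.1 (abs_coupling_mul_le hb hb' (abs_sin_mul_cos_le_left p.1 p.2))
  have e2 := abs_le.1 (abs_coupling_mul_le hb hb' (abs_sin_mul_cos_le_pi_sub p.1 p.2))
  simp only [diagMap, mem_Ioo] at h
  constructor
  · by_contra! h0
    rw [abs_of_nonpos h0] at e1
    linarith
  · by_contra! h0
    rw [abs_of_nonpos (by linarith : Real.pi - p.1 ≤ 0)] at e2
    linarith

theorem mem_openSquare_of_diagMap (hb : 0 < b) (hb' : b < 1 / 2) (hc : 0 < c)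
    (hc' : c < 1 / 2) {p : ℝ × ℝ}
    (h : diagMap b c p ∈ Ioo 0 (Real.pi / 2) ×ˢ Ioo 0 (Real.pi / 2)) :
    p ∈ Ioo 0 (Real.pi / 2) ×ˢ Ioo 0 (Real.pi / 2) := by
  have hpi := Real.pi_pos
  obtain ⟨⟨h1, h2⟩, h3, h4⟩ := h
  have i1 := fst_mem_Ioo_of_diagMap hb hb' ⟨h1, by linarith⟩
  have i2 := fst_mem_Ioo_of_diagMap hc hc' (p := p.swap) (c := b) ⟨h3, by
    change (diagMap b c p).2 < _
    linarith⟩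
  simp only [Prod.fst_swap] at i2
  have s1 := Real.sin_pos_of_mem_Ioo i1
  have s2 := Real.sin_pos_of_mem_Ioo i2
  have e1 := (abs_le.1 (abs_coupling_mul_le hb hb' (abs_sin_mul_cos_le_right p.1 p.2))).1
  have e2 := (abs_le.1 (abs_coupling_mul_le hc hc' (abs_sin_mul_cos_le_right p.2 p.1))).1
  obtain ⟨i1, i1'⟩ := i1
  obtain ⟨i2, i2'⟩ := i2
  simp only [diagMap] at h2 h4
  -- If only one coordinate were at or past π/2, it would not decrease. If both were, the
  -- half-distance bounds would make each image excess over π/2 incompatible with the other.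
  have k1 : Real.pi / 2 ≤ p.1 → Real.pi / 2 < p.2 := fun hge => by
    by_contra! hle
    have := mul_nonneg hb.le (mul_nonneg s1.le
      (Real.cos_nonneg_of_neg_pi_div_two_le_of_le (x := p.2) (by linarith) hle))
    linarith
  have k2 : Real.pi / 2 ≤ p.2 → Real.pi / 2 < p.1 := fun hge => by
    by_contra! hle
    have := mul_nonneg hc.le (mul_nonneg s2.le
      (Real.cos_nonneg_of_neg_pi_div_two_le_of_le (x := p.1) (by linarith) hle))
    linarith
  have k3 : ¬ (Real.pi / 2 ≤ p.1 ∧ Real.pi / 2 ≤ p.2) := fun ⟨l1, l2⟩ => by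
    rw [abs_of_nonpos (by linarith)] at e1 e2
    linarith
  refine ⟨⟨i1, not_le.1 fun h => k3 ⟨h, (k1 h).le⟩⟩, i2, not_le.1 fun h => k3 ⟨(k2 h).le, h⟩⟩

theorem tendsto_zero_of_backward_orbit (hb : 0 < b) (hb' : b < 1 / 2) (hc : 0 < c)
    (hc' : c < 1 / 2) {X : ℕ → ℝ × ℝ} (hX : ∀ n, diagMap b c (X (n + 1)) = X n)
    (h0 : X 0 ∈ Ioo 0 (Real.pi / 2) ×ˢ Ioo 0 (Real.pi / 2)) :
    Tendsto X atTop (𝓝 (0, 0)) := by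
  have hopen : ∀ n, X n ∈ Ioo 0 (Real.pi / 2) ×ˢ Ioo 0 (Real.pi / 2) := fun n => by
    induction n with
    | zero => exact h0
    | succ n ih => exact mem_openSquare_of_diagMap hb hb' hc hc' (hX n ▸ ih)
  have hmem : ∀ n, X n ∈ baseSquare := fun n =>
    ⟨Ioo_subset_Icc_self (hopen n).1, Ioo_subset_Icc_self (hopen n).2⟩
  have hanti : Antitone X := antitone_nat_of_succ_le fun n => by
    have := le_diagMap hb hc (hmem (n + 1))
    rwa [hX] at this
  have ht1 := tendsto_atTop_ciInf (monotone_fst.comp_antitone hanti)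
    ⟨0, by rintro _ ⟨n, rfl⟩; exact (hmem n).1.1⟩
  have ht2 := tendsto_atTop_ciInf (monotone_snd.comp_antitone hanti)
    ⟨0, by rintro _ ⟨n, rfl⟩; exact (hmem n).2.1⟩
  obtain ⟨L, ht⟩ : ∃ L, Tendsto X atTop (𝓝 L) := ⟨_, ht1.prodMk_nhds ht2⟩
  have hLmem : L ∈ baseSquare := isClosed_baseSquare.mem_of_tendsto ht (Eventually.of_forall hmem)
  have hfix : diagMap b c L = L := by
    have k1 := ((continuous_diagMap b c).tendsto L).comp ((tendsto_add_atTop_iff_nat 1).2 ht)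
    have k2 : (diagMap b c ∘ fun n => X (n + 1)) = X := funext hX
    rw [k2] at k1
    exact tendsto_nhds_unique k1 ht
  have hle : L ≤ X 0 := hanti.le_of_tendsto ht 0
  rcases eq_of_diagMap_eq_self hb hc hLmem hfix with h | h
  · rwa [h] at ht
  · rw [h] at hle
    exact absurd hle.1 (not_le.2 h0.1.2)

/-! ### Return to the original coordinates -/

theorem F_semiconj (a : ℝ) : Function.Semiconj diagHomeo (F a) (diagMap (3 * a) a) := by
  intro p
  have h1 : p.1 = (p.1 + p.2) / 2 + (p.1 - p.2) / 2 := by ring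
  have h2 : p.2 = (p.1 + p.2) / 2 - (p.1 - p.2) / 2 := by ring
  have s1 : Real.sin p.1 = _ := (congrArg Real.sin h1).trans (Real.sin_add _ _)
  have s2 : Real.sin p.2 = _ := (congrArg Real.sin h2).trans (Real.sin_sub _ _)
  simp only [diagHomeo_apply, F, diagMap, s1, s2]
  ext <;> simp only <;> ring

theorem iterate_F (a : ℝ) (n : ℕ) (p : ℝ × ℝ) :
    diagHomeo ((F a)^[n] p) = (diagMap (3 * a) a)^[n] (diagHomeo p) :=
  ((F_semiconj a).iterate_right n).eq p

theorem diagHomeo_pi : diagHomeo (Real.pi, 0) = (Real.pi / 2, Real.pi / 2) := by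
  simp [diagHomeo_apply]

theorem diagHomeo_zero : diagHomeo (0, 0) = (0, 0) := by
  simp [diagHomeo_apply]

theorem s₁_eq : s₁ = diagHomeo ⁻¹' baseSquare := by
  ext p
  simp only [s₁, baseSquare, diagHomeo_apply, mem_ofPred_eq, mem_preimage, mem_prod, mem_Icc]
  constructor
  · rintro ⟨⟨_, _⟩, _, _⟩
    refine ⟨⟨?_, ?_⟩, ?_, ?_⟩ <;> linarith
  · rintro ⟨⟨_, _⟩, _, _⟩
    refine ⟨⟨?_, ?_⟩, ?_, ?_⟩ <;> linarith

theorem s₂_eq : s₂ = diagHomeo ⁻¹' rightSquare := by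
  ext p
  simp only [s₂, rightSquare, diagHomeo_apply, mem_ofPred_eq, mem_preimage, mem_prod, mem_Icc]
  constructor
  · rintro ⟨⟨_, _⟩, _, _⟩
    refine ⟨⟨?_, ?_⟩, ?_, ?_⟩ <;> linarith
  · rintro ⟨⟨_, _⟩, _, _⟩
    refine ⟨⟨?_, ?_⟩, ?_, ?_⟩ <;> linarith

theorem s₃_eq : s₃ = diagHomeo ⁻¹' (Prod.swap ⁻¹' rightSquare) := by
  ext p
  simp only [s₃, rightSquare, diagHomeo_apply, mem_ofPred_eq, mem_preimage, mem_prod, mem_Icc, Prod.fst_swap, Prod.snd_swap]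
  constructor
  · rintro ⟨⟨_, _⟩, _, _⟩
    refine ⟨⟨?_, ?_⟩, ?_, ?_⟩ <;> linarith
  · rintro ⟨⟨_, _⟩, _, _⟩
    refine ⟨⟨?_, ?_⟩, ?_, ?_⟩ <;> linarith

theorem interior_s₁ :
    interior s₁ = diagHomeo ⁻¹' (Ioo 0 (Real.pi / 2) ×ˢ Ioo 0 (Real.pi / 2)) := by
  rw [s₁_eq, ← Homeomorph.preimage_interior, baseSquare, interior_prod_eq, interior_Icc]

theorem γL_eq (a : ℝ) : γL a = diagHomeo ⁻¹' diagCurve (3 * a) a := by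
  rw [γL, interior_s₁, diagCurve, preimage_inter]
  congr 1
  ext p
  simp only [stableSet, mem_ofPred_eq, mem_preimage, ← iterate_F, ← diagHomeo_pi]
  exact diagHomeo.isInducing.tendsto_nhds_iff

theorem LeavesInto.of_semiconj {f g T : ℝ × ℝ → ℝ × ℝ} (h : Function.Semiconj T f g)
    {p : ℝ × ℝ} {A B : Set (ℝ × ℝ)} (hp : LeavesInto g (T p) A B) :
    LeavesInto f p (T ⁻¹' A) (T ⁻¹' B) := by
  obtain ⟨N, h1, h2, h3⟩ := hp
  have e := fun n : ℕ => (h.iterate_right n).eq p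
  refine ⟨N, fun n hn => ?_, fun n hn => ?_, fun n hn => ?_⟩
  · exact ⟨by simpa only [mem_preimage, e] using (h1 n hn).1,
      by simpa only [mem_preimage, e] using (h1 n hn).2⟩
  · simpa only [mem_preimage, e] using h2 n hn
  · simpa only [mem_preimage, e] using h3 n hn

/-- A preimage of w is a fixed point of p ↦ w - (F p - p), a sup-norm contraction since 3a < 1/2. -/
theorem F_surjective {a : ℝ} (ha : 0 < a) (ha' : a < 1 / 6) : Function.Surjective (F a) := by
  intro w
  let f : ℝ × ℝ → ℝ × ℝ := fun p =>
    (w.1 - (2 * a * Real.sin p.1 + a * Real.sin p.2),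
      w.2 - (a * Real.sin p.1 + 2 * a * Real.sin p.2))
  have hsin : ∀ s t, |Real.sin s - Real.sin t| ≤ |s - t| := fun s t => by
    simpa [Real.dist_eq] using Real.lipschitzWith_sin.dist_le_mul s t
  have hf : ContractingWith (1 / 2) f := by
    refine ⟨by rw [← NNReal.coe_lt_coe]; norm_num, LipschitzWith.of_dist_le_mul fun p q => ?_⟩
    have d1 : |p.1 - q.1| ≤ dist p q := le_max_left _ _
    have d2 : |p.2 - q.2| ≤ dist p q := le_max_right _ _
    obtain ⟨l1, u1⟩ := abs_le.1 ((hsin p.1 q.1).trans d1)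
    obtain ⟨l2, u2⟩ := abs_le.1 ((hsin p.2 q.2).trans d2)
    have hd : 0 ≤ dist p q := dist_nonneg
    rw [Prod.dist_eq]
    refine max_le ?_ ?_ <;> rw [Real.dist_eq, abs_le] <;> simp only [f] <;> push_cast <;>
      constructor <;> nlinarith
  have hfix : f (hf.fixedPoint f) = hf.fixedPoint f := hf.fixedPoint_isFixedPt
  set p := hf.fixedPoint f
  have h1 : w.1 - (2 * a * Real.sin p.1 + a * Real.sin p.2) = p.1 := congrArg Prod.fst hfix
  have h2 : w.2 - (a * Real.sin p.1 + 2 * a * Real.sin p.2) = p.2 := congrArg Prod.snd hfix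
  exact ⟨p, Prod.ext (by simp only [F]; linarith) (by simp only [F]; linarith)⟩

variable {a : ℝ}

theorem preimage_interior_s₁_subset (ha : 0 < a) (ha' : a < 1 / 6) :
    F a ⁻¹' interior s₁ ⊆ interior s₁ := by
  intro p hp
  rw [interior_s₁, mem_preimage, mem_preimage, (F_semiconj a).eq] at hp
  rw [interior_s₁, mem_preimage]
  exact mem_openSquare_of_diagMap (by linarith) (by linarith) ha (by linarith) hp

theorem image_γL (ha : 0 < a) (ha' : a < 1 / 6) : F a '' γL a = γL a := by
  apply Subset.antisymm
  · rintro _ ⟨p, hp, rfl⟩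
    rw [γL_eq, mem_preimage] at hp ⊢
    rw [(F_semiconj a).eq]
    exact diagMap_mem_diagCurve (by linarith) (by linarith) ha (by linarith) hp
  · intro w hw
    obtain ⟨p, rfl⟩ := F_surjective ha ha' w
    exact ⟨p, ⟨(tendsto_add_atTop_iff_nat (f := fun n => (F a)^[n] p) 1).1 hw.1,
      preimage_interior_s₁_subset ha ha' hw.2⟩, rfl⟩

/-- These bounds squeeze y to 0 at both ends of the curve. -/
theorem abs_snd_lt_of_mem_γL {p : ℝ × ℝ} (hp : p ∈ γL a) :
    |p.2| < p.1 ∧ |p.2| < Real.pi - p.1 := by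
  have h := hp.2
  rw [interior_s₁] at h
  obtain ⟨⟨h1, h2⟩, h3, h4⟩ := h
  simp only [diagHomeo_apply] at h1 h2 h3 h4
  constructor <;> rw [abs_lt] <;> constructor <;> linarith

/-- This is the chain property read in (x, y); it yields both uniqueness of y and continuity of the
graph. -/
theorem abs_snd_sub_le_of_mem_γL (ha : 0 < a) (ha' : a < 1 / 6) {p q : ℝ × ℝ}
    (hp : p ∈ γL a) (hq : q ∈ γL a) : |p.2 - q.2| ≤ |p.1 - q.1| := by
  have key : ∀ {p q : ℝ × ℝ}, p ∈ γL a → q ∈ γL a → p.2 - q.2 ≤ |p.1 - q.1| := by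
    intro p q hp hq
    by_contra! h
    obtain ⟨h1, h2⟩ := abs_lt.1 h
    rw [γL_eq] at hp hq
    have := diagHomeo.injective <| diagCurve_chain (by linarith) (by linarith) ha (by linarith)
      hp hq (by simp only [diagHomeo_apply]; linarith)
      (by simp only [diagHomeo_apply]; linarith)
    simp [this] at h
  rw [abs_le]
  have := key hp hq
  have := key hq hp
  rw [abs_sub_comm] at this
  constructor <;> linarith

theorem existsUnique_mem_γL (ha : 0 < a) (ha' : a < 1 / 6) {x : ℝ} (hx : x ∈ Ioo 0 Real.pi) :
    ∃! y, (x, y) ∈ γL a := by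
  obtain ⟨t, ht⟩ := exists_mem_diagCurve (b := 3 * a) (c := a) (by linarith) (by linarith) ha
    (by linarith) hx
  have hmem : (x, 2 * t - x) ∈ γL a := by
    rw [γL_eq, mem_preimage]
    convert ht using 1
    ext <;> simp only [diagHomeo_apply] <;> ring
  refine ⟨2 * t - x, hmem, fun y hy => ?_⟩
  have := abs_snd_sub_le_of_mem_γL ha ha' hy hmem
  simpa [sub_eq_zero] using this

theorem exists_curve_γL (ha : 0 < a) (ha' : a < 1 / 6) :
    ∃ c : ℝ → ℝ × ℝ, Continuous c ∧ Function.Injective c ∧ range c = γL a ∧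
      Tendsto c atBot (𝓝 (0, 0)) ∧ Tendsto c atTop (𝓝 (Real.pi, 0)) := by
  -- The abscissa π/2 + arctan t parametrizes the graph over (0, π) by the whole line.
  have hx : ∀ t, Real.pi / 2 + Real.arctan t ∈ Ioo 0 Real.pi := fun t =>
    ⟨by linarith [Real.neg_pi_div_two_lt_arctan t], by linarith [Real.arctan_lt_pi_div_two t]⟩
  choose h hh using fun t => (existsUnique_mem_γL ha ha' (hx t)).exists
  have hb0 : Tendsto (fun t => Real.pi / 2 + Real.arctan t) atBot (𝓝 0) := by
    simpa using (Real.tendsto_arctan_atBot.mono_right nhdsWithin_le_nhds).const_add (Real.pi / 2)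
  have ht0 : Tendsto (fun t => Real.pi / 2 + Real.arctan t) atTop (𝓝 Real.pi) := by
    simpa using (Real.tendsto_arctan_atTop.mono_right nhdsWithin_le_nhds).const_add (Real.pi / 2)
  have hcont : Continuous h := by
    refine continuous_iff_continuousAt.2 fun t => tendsto_iff_dist_tendsto_zero.2 ?_
    have hlim : Tendsto (fun s => |Real.arctan s - Real.arctan t|) (𝓝 t) (𝓝 0) := by
      have : Continuous fun s => |Real.arctan s - Real.arctan t| := by fun_prop
      simpa using this.tendsto t
    refine squeeze_zero (fun _ => dist_nonneg) (fun s => ?_) hlim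
    simpa [Real.dist_eq] using abs_snd_sub_le_of_mem_γL ha ha' (hh s) (hh t)
  refine ⟨fun t => (Real.pi / 2 + Real.arctan t, h t), by fun_prop, fun s t hst => ?_, ?_, ?_, ?_⟩
  · have := congrArg Prod.fst hst
    exact Real.arctan_injective (by simpa using this)
  · refine Subset.antisymm (range_subset_iff.2 hh) fun p hp => ?_
    obtain ⟨h1, h2⟩ := abs_snd_lt_of_mem_γL hp
    have := abs_nonneg p.2
    have hx' : p.1 ∈ Ioo 0 Real.pi := ⟨by linarith, by linarith⟩
    have e : Real.pi / 2 + Real.arctan (Real.tan (p.1 - Real.pi / 2)) = p.1 := by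
      rw [Real.arctan_tan (by linarith [hx'.1]) (by linarith [hx'.2])]
      ring
    refine ⟨Real.tan (p.1 - Real.pi / 2), Prod.ext e ?_⟩
    refine (existsUnique_mem_γL ha ha' hx').unique ?_ hp
    have := hh (Real.tan (p.1 - Real.pi / 2))
    rwa [e] at this
  · exact hb0.prodMk_nhds <| squeeze_zero_norm
      (fun t => (abs_snd_lt_of_mem_γL (hh t)).1.le) hb0
  · refine ht0.prodMk_nhds <| squeeze_zero_norm
      (fun t => (abs_snd_lt_of_mem_γL (hh t)).2.le) ?_
    simpa using ht0.const_sub Real.pi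

theorem tendsto_orbit_of_mem_γL (ha : 0 < a) (ha' : a < 1 / 6) {X : ℤ → ℝ × ℝ}
    (hX : ∀ n, X (n + 1) = F a (X n)) (h0 : X 0 ∈ γL a) :
    Tendsto X atBot (𝓝 (0, 0)) ∧ Tendsto X atTop (𝓝 (Real.pi, 0)) := by
  constructor
  · have hneg : Tendsto (fun n : ℕ => X (-(n : ℤ))) atTop (𝓝 (0, 0)) := by
      rw [diagHomeo.isInducing.tendsto_nhds_iff, diagHomeo_zero]
      refine tendsto_zero_of_backward_orbit (b := 3 * a) (c := a) (by linarith) (by linarith) ha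
        (by linarith) (fun n => ?_) ?_
      · simp only [Function.comp_apply]
        rw [← (F_semiconj a).eq, ← hX]
        congr 2
        push_cast
        ring
      · rw [γL_eq] at h0
        exact h0.2
    have h1 : Tendsto (fun n : ℤ => X (-n)) atTop (𝓝 (0, 0)) := by
      rw [← Nat.map_cast_int_atTop, tendsto_map'_iff]
      exact hneg
    simpa [Function.comp_def] using h1.comp tendsto_neg_atBot_atTop
  · rw [← Nat.map_cast_int_atTop, tendsto_map'_iff]
    have : X ∘ (Nat.cast : ℕ → ℤ) = fun n => (F a)^[n] (X 0) := funext fun n => by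
      induction n with
      | zero => rfl
      | succ n ih =>
        rw [Function.iterate_succ_apply', ← ih]
        exact_mod_cast hX n
    rw [this]
    exact h0.1

theorem leavesInto_s₂_of_isAbove (ha : 0 < a) (ha' : a < 1 / 6) {p : ℝ × ℝ} (hp : p ∈ s₁)
    (h : IsAbove p (γL a)) : LeavesInto (F a) p s₁ s₂ := by
  obtain ⟨y, hy, hlt⟩ := h
  rw [γL_eq] at hy
  rw [s₁_eq] at hp
  rw [s₁_eq, s₂_eq]
  refine LeavesInto.of_semiconj (F_semiconj a) (leavesInto_of_right_of_diagCurve (by linarith)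
    (by linarith) ha (by linarith) hp hy ?_ ?_) <;>
  · simp only [diagHomeo_apply]
    linarith

theorem leavesInto_s₃_of_isBelow (ha : 0 < a) (ha' : a < 1 / 6) {p : ℝ × ℝ} (hp : p ∈ s₁)
    (h : IsBelow p (γL a)) : LeavesInto (F a) p s₁ s₃ := by
  obtain ⟨y, hy, hlt⟩ := h
  rw [γL_eq] at hy
  rw [s₁_eq] at hp
  -- The square is its own mirror image, so the right-exit result transfers through the swap.
  have hswap : baseSquare = Prod.swap ⁻¹' baseSquare := ext fun _ => swap_mem_baseSquare.symm
  rw [s₁_eq, s₃_eq, hswap]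
  refine LeavesInto.of_semiconj (F_semiconj a) (LeavesInto.of_semiconj
    (diagMap_semiconj_swap _ _) (leavesInto_of_right_of_diagCurve ha (by linarith) (by linarith)
    (by linarith) (swap_mem_baseSquare.2 hp) (swap_mem_diagCurve hy) ?_ ?_)) <;>
  · simp only [diagHomeo_apply, Prod.fst_swap, Prod.snd_swap]
    linarith

end

end ThreeClocks

theorem mainTheorem5 (a : ℝ) (ha : 0 < a) (ha' : a < 1 / 6) :
    -- `γL` is a heteroclinic curve from `(0,0)` to `(π,0)`, met exactly once by each vertical line
    ThreeClocks.IsHeteroclinicCurve (ThreeClocks.F a) (0, 0) (Real.pi, 0) (ThreeClocks.γL a) ∧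
    (∀ x ∈ Set.Ioo 0 Real.pi, ∃! y, (x, y) ∈ ThreeClocks.γL a) ∧
    -- the interior of `s₁` is negatively invariant
    ThreeClocks.F a ⁻¹' interior ThreeClocks.s₁ ⊆ interior ThreeClocks.s₁ ∧
    -- orbits starting above `γL` cross into `s₂`, those starting below cross into `s₃`
    (∀ p ∈ ThreeClocks.s₁, ThreeClocks.IsAbove p (ThreeClocks.γL a) →
      ThreeClocks.LeavesInto (ThreeClocks.F a) p ThreeClocks.s₁ ThreeClocks.s₂) ∧
    (∀ p ∈ ThreeClocks.s₁, ThreeClocks.IsBelow p (ThreeClocks.γL a) →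
      ThreeClocks.LeavesInto (ThreeClocks.F a) p ThreeClocks.s₁ ThreeClocks.s₃) := by
  open ThreeClocks in
  exact ⟨⟨exists_curve_γL ha ha', image_γL ha ha', fun _ => tendsto_orbit_of_mem_γL ha ha'⟩,
    fun _ => existsUnique_mem_γL ha ha', preimage_interior_s₁_subset ha ha',
    fun _ => leavesInto_s₂_of_isAbove ha ha', fun _ => leavesInto_s₃_of_isBelow ha ha'⟩
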